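/- All graphs are finite and simple. A \emph{cluster} is a disjoint union of complete graphs (equivalently, the complement of a complete multipartite graph). For a non-negative integer $k$, a graph $G$ is \emph{$(\infty,k)$-polar} if its vertex set can be partitioned into two (possibly empty) sets $A$ and $B$ such that $A$ induces a complete multipartite graph (with any number of parts) and $B$ induces a cluster with at most $k$ connected components. A \emph{cograph} is a graph with no induced path on four vertices. A \emph{cograph minimal $(\infty,k)$-polar obstruction} is a cograph that is not $(\infty,k)$-polar but all of whose proper induced subgraphs are $(\infty,k)$-polar; it is of \emph{type} $(c,i)$ if it has exactly $c$ connected components, precisely $i$ of which consist of a single vertex. Write $G+H$ for the disjoint union and $G\oplus H$ for the join of $G$ and $H$, and $nG$ for the disjoint union of $n$ copies of $G$. Let $k\ge 2$ be an integer and let $G$ be a graph. Then $G$ is a cograph minimal $(\infty,k)$-polar obstruction of type $(k+2,k+1)$ if and only if $G$ is isomorphic to $(k+1)K_1+K_{k+1,k+1}$ or to $(k+1)K_1+(K_1\oplus C_4)$. -/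

import Mathlib

namespace CographPolar

open SimpleGraph

universe u v

/-- The join of two graphs: the disjoint union together with all edges between the two sides. -/
def join {V : Type u} {W : Type v} (G : SimpleGraph V) (H : SimpleGraph W) :
    SimpleGraph (V ⊕ W) where
  Adj
    | Sum.inl a, Sum.inl b => G.Adj a b
    | Sum.inr a, Sum.inr b => H.Adj a b
    | Sum.inl _, Sum.inr _ => True
    | Sum.inr _, Sum.inl _ => True
  symm := ⟨by
    rintro (a | a) (b | b) h
    · exact G.adj_symm h
    · trivial
    · trivial
    · exact H.adj_symm h⟩
  loopless := ⟨by
    rintro (a | a) h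
    · exact G.irrefl h
    · exact H.irrefl h⟩

/-- A cograph: a graph without an induced path on four vertices. -/
def IsCograph {V : Type u} (G : SimpleGraph V) : Prop :=
  ¬ (pathGraph 4).IsIndContained G

/-- `G` is a complete multipartite graph with at most `s` parts. The parts are the classes of the
relation "equal or non-adjacent". -/
def IsCompletePartite {V : Type u} (G : SimpleGraph V) (s : ℕ∞) : Prop :=
  ∃ h : G.IsCompleteMultipartite, ENat.card (Quotient h.setoid) ≤ s

/-- A cluster: the complement of a complete multipartite graph. -/
def IsCluster {V : Type u} (G : SimpleGraph V) : Prop :=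
  Gᶜ.IsCompleteMultipartite

/-- A `k`-cluster: a cluster with at most `k` connected components. -/
def IsKCluster {V : Type u} (G : SimpleGraph V) (k : ℕ∞) : Prop :=
  IsCluster G ∧ ENat.card G.ConnectedComponent ≤ k

/-- `(A, V \ A)` is an `(s, k)`-polar partition of `G` (either side may be empty); `s = ⊤` or
`k = ⊤` means that the number of parts, respectively of components, is unbounded. -/
def IsPolarPartition {V : Type u} (G : SimpleGraph V) (s k : ℕ∞) (A : Set V) : Prop :=
  IsCompletePartite (G.induce A) s ∧ IsKCluster (G.induce Aᶜ) k

/-- `G` is `(s, k)`-polar. -/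
def IsPolar {V : Type u} (G : SimpleGraph V) (s k : ℕ∞) : Prop :=
  ∃ A : Set V, IsPolarPartition G s k A

/-- `G` is a cograph minimal `(s, k)`-polar obstruction: a cograph that is not `(s, k)`-polar, all
of whose proper induced subgraphs are `(s, k)`-polar. -/
def IsCographMinimalObstruction {V : Type u} (G : SimpleGraph V) (s k : ℕ∞) : Prop :=
  IsCograph G ∧ ¬ IsPolar G s k ∧ ∀ X : Set V, X ≠ Set.univ → IsPolar (G.induce X) s k

/-- `G` has exactly `c` connected components, precisely `i` of which are trivial, that is, consist
of a single vertex. -/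
def HasType {V : Type u} (G : SimpleGraph V) (c i : ℕ) : Prop :=
  ENat.card G.ConnectedComponent = c ∧
    {C : G.ConnectedComponent | ∃ x : V, C.supp = {x}}.encard = i

/-- The edgeless graph on `n` vertices, i.e. the disjoint union `n K₁` of `n` copies of `K₁`. -/
def isolated (n : ℕ) : SimpleGraph (Fin n) := ⊥

end CographPolar

namespace CographPolar

open SimpleGraph

universe u v

/-! Let `I` be the set of `k + 1` isolated vertices of a minimal obstruction `G`. Delete one of them
and take a polar partition `(A, B)` of the rest. An isolated vertex in `A` would make `A`
independent, so the deleted vertex could join it and `G` would be polar. Hence the other `k`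
isolated vertices are in `B` and use up its `k` components, so every non-isolated vertex is in `A`:
these vertices induce a complete multipartite graph (`IsCographMinimalObstruction.multipartiteOn`).
Non-polarity then forces `K₁ ⊕ C₄` if there are at least three parts, and two sides of size at least
`k + 1` if there are two (`exists_embedding_of_not_isPolar`). Adding the isolated vertices gives a
non-polar induced subgraph, which by minimality is all of `G`.

Conversely, if `(k + 1) K₁ + H` is polar, some isolated vertex is in `A`, so `H` must split into an
independent set and a `k`-cluster (`exists_indep_cover_of_isPolar_isolated_sum`). Neither `H` has
such a splitting, but each gains one when any vertex is deleted. -/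

/-- The vertices in `A` induce a complete multipartite graph. -/
def MultipartiteOn {V : Type u} (G : SimpleGraph V) (A : Set V) : Prop :=
  ∀ ⦃x⦄, x ∈ A → ∀ ⦃y⦄, y ∈ A → ∀ ⦃z⦄, z ∈ A → ¬ G.Adj x y → ¬ G.Adj y z → ¬ G.Adj x z

/-- The vertices in `B` induce a graph without an induced path on three vertices. -/
def ClusterOn {V : Type u} (G : SimpleGraph V) (B : Set V) : Prop :=
  ∀ ⦃x⦄, x ∈ B → ∀ ⦃y⦄, y ∈ B → ∀ ⦃z⦄, z ∈ B → G.Adj x y → G.Adj y z → x ≠ z → G.Adj x z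

/-- Every independent set inside `B` has at most `k` elements. -/
def IndepLe {V : Type u} (G : SimpleGraph V) (B : Set V) (k : ℕ∞) : Prop :=
  ∀ T ⊆ B, G.IsIndepSet T → T.encard ≤ k

/-! ### Polarity in terms of vertex sets -/

section Sets

variable {V : Type u} {W : Type v} {G : SimpleGraph V} {H : SimpleGraph W}

lemma MultipartiteOn.of_isIndepSet {A : Set V} (h : G.IsIndepSet A) : MultipartiteOn G A := by
  intro x hx y _ z hz _ _ hxz
  exact h hx hz hxz.ne hxz

lemma ClusterOn.of_isIndepSet {B : Set V} (h : G.IsIndepSet B) : ClusterOn G B := by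
  intro x hx y hy z _ hxy _ _
  exact absurd hxy (h hx hy hxy.ne)

lemma ClusterOn.of_isClique {B : Set V} (h : G.IsClique B) : ClusterOn G B :=
  fun _ hx _ _ _ hz _ _ hxz => h hx hz hxz

lemma ClusterOn.mono {B C : Set V} (h : ClusterOn G C) (hBC : B ⊆ C) : ClusterOn G B :=
  fun _ hx _ hy _ hz => h (hBC hx) (hBC hy) (hBC hz)

lemma IndepLe.mono {B C : Set V} {k : ℕ∞} (h : IndepLe G C k) (hBC : B ⊆ C) : IndepLe G B k :=
  fun T hT => h T (hT.trans hBC)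

lemma IndepLe.of_encard_le {B : Set V} {k : ℕ∞} (h : B.encard ≤ k) : IndepLe G B k :=
  fun _ hT _ => (Set.encard_le_encard hT).trans h

lemma IndepLe.of_isClique {B : Set V} {k : ℕ∞} (h : G.IsClique B) (hk : 1 ≤ k) :
    IndepLe G B k := by
  intro T hT hind
  refine le_trans (Set.encard_le_one_iff.2 fun a b ha hb => ?_) hk
  by_contra hab
  exact hind ha hb hab (h (hT ha) (hT hb) hab)

lemma MultipartiteOn.preimage {A : Set W} (h : MultipartiteOn H A) (f : G ↪g H) :
    MultipartiteOn G (f ⁻¹' A) := by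
  intro x hx y hy z hz hxy hyz
  simpa using h hx hy hz (by simpa using hxy) (by simpa using hyz)

lemma ClusterOn.preimage {B : Set W} (h : ClusterOn H B) (f : G ↪g H) :
    ClusterOn G (f ⁻¹' B) := by
  intro x hx y hy z hz hxy hyz hxz
  simpa using h hx hy hz (by simpa using hxy) (by simpa using hyz) (f.injective.ne hxz)

lemma IndepLe.preimage {B : Set W} {k : ℕ∞} (h : IndepLe H B k) (f : G ↪g H) :
    IndepLe G (f ⁻¹' B) k := by
  intro T hT hind
  rw [← f.injective.encard_image]
  refine h _ (Set.image_subset_iff.2 hT) ?_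
  rintro _ ⟨x, hx, rfl⟩ _ ⟨y, hy, rfl⟩ hxy
  simpa using hind hx hy fun e => hxy (congrArg f e)

lemma ClusterOn.eq_or_adj_of_reachable (h : ClusterOn G Set.univ) {x y : V}
    (hxy : G.Reachable x y) : x = y ∨ G.Adj x y := by
  obtain ⟨p⟩ := hxy
  induction p with
  | nil => exact Or.inl rfl
  | @cons a b c hab _ ih =>
    rcases ih with rfl | hbc
    · exact Or.inr hab
    · by_cases hac : a = c
      · exact Or.inl hac
      · exact Or.inr (h trivial trivial trivial hab hbc hac)

/-- The components of a cluster are cliques: an independent set meets each at most once, and one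
representative of each gives an independent set. Unlike components, independent sets restrict
directly to subsets and pull back along embeddings. -/
lemma card_connectedComponent_le_iff (h : ClusterOn G Set.univ) (k : ℕ∞) :
    ENat.card G.ConnectedComponent ≤ k ↔ IndepLe G Set.univ k := by
  constructor
  · intro hk T _ hT
    have hinj : Set.InjOn G.connectedComponentMk T := by
      intro x hx y hy hxy
      rcases h.eq_or_adj_of_reachable (ConnectedComponent.exact hxy) with e | e
      · exact e
      · exact absurd e (hT hx hy e.ne)
    rw [← hinj.encard_image]
    exact Set.encard_le_card.trans hk
  · intro hk
    have hout : ∀ C : G.ConnectedComponent, G.connectedComponentMk (Quot.out C) = C :=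
      fun C => Quot.out_eq C
    have hinj : Function.Injective (fun C : G.ConnectedComponent => Quot.out C) :=
      fun C D hCD => by rw [← hout C, ← hout D]; exact congrArg _ hCD
    rw [← Set.encard_univ, ← hinj.encard_image]
    refine hk _ (Set.subset_univ _) ?_
    rintro _ ⟨C, -, rfl⟩ _ ⟨D, -, rfl⟩ hCD hadj
    apply hCD
    have := ConnectedComponent.sound hadj.reachable
    change G.connectedComponentMk _ = G.connectedComponentMk _ at this
    rw [hout, hout] at this
    rw [this]

lemma isCluster_iff : IsCluster G ↔ ClusterOn G Set.univ := by
  constructor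
  · intro h x _ y _ z _ hxy hyz hxz
    by_contra hn
    exact h.trans x y z (by simp [hxy]) (by simp [hyz]) (by simp [hxz, hn])
  · intro h
    refine ⟨fun x y z hxy hyz hxz => ?_⟩
    simp only [compl_adj, not_and, not_not] at hxy hyz hxz
    by_cases e : x = y
    · subst e; exact hxz.2 (hyz hxz.1)
    by_cases e' : y = z
    · subst e'; exact hxz.2 (hxy hxz.1)
    exact hxz.2 (h trivial trivial trivial (hxy e) (hyz e') hxz.1)

lemma isKCluster_iff (k : ℕ∞) :
    IsKCluster G k ↔ ClusterOn G Set.univ ∧ IndepLe G Set.univ k := by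
  rw [IsKCluster, isCluster_iff]
  exact and_congr_right fun h => card_connectedComponent_le_iff h k

lemma clusterOn_induce (B : Set V) : ClusterOn (G.induce B) Set.univ ↔ ClusterOn G B := by
  constructor
  · intro h x hx y hy z hz hxy hyz hxz
    exact h (x := ⟨x, hx⟩) trivial (y := ⟨y, hy⟩) trivial (z := ⟨z, hz⟩) trivial hxy hyz
      (by simpa using hxz)
  · rintro h ⟨x, hx⟩ _ ⟨y, hy⟩ _ ⟨z, hz⟩ _ hxy hyz hxz
    exact h hx hy hz hxy hyz (by simpa using hxz)

lemma indepLe_induce (B : Set V) (k : ℕ∞) :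
    IndepLe (G.induce B) Set.univ k ↔ IndepLe G B k := by
  constructor
  · intro h T hT hind
    have hT' : Subtype.val '' ((↑) ⁻¹' T : Set B) = T := by
      rw [Subtype.image_preimage_coe]; exact Set.inter_eq_right.2 hT
    rw [← hT', Subtype.val_injective.encard_image]
    refine h _ (Set.subset_univ _) fun x hx y hy hxy => ?_
    exact hind hx hy fun e => hxy (Subtype.ext e)
  · intro h
    exact (h.preimage (Embedding.induce B)).mono fun x _ => x.2

/-- The two sets may overlap, since the conditions on `B` pass to subsets; witnesses need not be
complements. -/
lemma isPolar_iff (k : ℕ∞) :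
    IsPolar G ⊤ k ↔ ∃ A B : Set V, (∀ x, x ∈ A ∨ x ∈ B) ∧
      MultipartiteOn G A ∧ ClusterOn G B ∧ IndepLe G B k := by
  have key : ∀ A : Set V, IsPolarPartition G ⊤ k A ↔
      MultipartiteOn G A ∧ ClusterOn G Aᶜ ∧ IndepLe G Aᶜ k := by
    intro A
    rw [IsPolarPartition, isKCluster_iff, clusterOn_induce, indepLe_induce]
    refine and_congr_left fun _ => ⟨?_, fun h => ⟨⟨?_⟩, le_top⟩⟩
    · rintro ⟨h, -⟩ x hx y hy z hz hxy hyz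
      exact h.trans ⟨x, hx⟩ ⟨y, hy⟩ ⟨z, hz⟩ hxy hyz
    · rintro ⟨x, hx⟩ ⟨y, hy⟩ ⟨z, hz⟩ hxy hyz
      exact h hx hy hz hxy hyz
  constructor
  · rintro ⟨A, hA⟩
    exact ⟨A, Aᶜ, fun x => em _, (key A).1 hA⟩
  · rintro ⟨A, B, hAB, hA, hB, hk⟩
    have hsub : Aᶜ ⊆ B := fun x hx => (hAB x).resolve_left hx
    exact ⟨A, (key A).2 ⟨hA, hB.mono hsub, hk.mono hsub⟩⟩

lemma IsPolar.of_embedding {k : ℕ∞} (f : G ↪g H) (h : IsPolar H ⊤ k) : IsPolar G ⊤ k := by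
  rw [isPolar_iff] at h ⊢
  obtain ⟨A, B, hAB, hA, hB, hk⟩ := h
  exact ⟨f ⁻¹' A, f ⁻¹' B, fun x => hAB (f x), hA.preimage f, hB.preimage f, hk.preimage f⟩

/-- Deleting vertices from a graph whose remaining vertices are covered by a multipartite and a
cluster part yields a polar graph. -/
lemma isPolar_induce_of_cover {k : ℕ∞} {X A B : Set V} (hX : X ⊆ A ∪ B)
    (hA : MultipartiteOn G A) (hB : ClusterOn G B) (hk : IndepLe G B k) :
    IsPolar (G.induce X) ⊤ k := by
  let f : G.induce X ↪g G := Embedding.induce X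
  exact (isPolar_iff k).2 ⟨f ⁻¹' A, f ⁻¹' B, fun x => hX x.2, hA.preimage f, hB.preimage f,
    hk.preimage f⟩

lemma exists_cover_of_isPolar_induce {k : ℕ∞} {X : Set V} (h : IsPolar (G.induce X) ⊤ k) :
    ∃ A B : Set V, X = A ∪ B ∧ MultipartiteOn G A ∧ ClusterOn G B ∧ IndepLe G B k := by
  obtain ⟨A, hA, hB⟩ := h
  rw [isKCluster_iff] at hB
  refine ⟨(↑) '' A, (↑) '' Aᶜ, ?_, ?_, ?_, ?_⟩
  · rw [← Set.image_union, Set.union_compl_self, Set.image_univ, Subtype.range_coe]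
  · rintro _ ⟨x, hx, rfl⟩ _ ⟨y, hy, rfl⟩ _ ⟨z, hz, rfl⟩ hxy hyz
    exact hA.1.trans ⟨x, hx⟩ ⟨y, hy⟩ ⟨z, hz⟩ hxy hyz
  · rintro _ ⟨x, hx, rfl⟩ _ ⟨y, hy, rfl⟩ _ ⟨z, hz, rfl⟩ hxy hyz hxz
    exact (clusterOn_induce _).1 hB.1 hx hy hz hxy hyz fun e => hxz (congrArg _ e)
  · intro T hT hind
    have hT' : Subtype.val '' ((↑) ⁻¹' T : Set X) = T := by
      rw [Subtype.image_preimage_coe]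
      exact Set.inter_eq_right.2 (hT.trans (by rintro _ ⟨x, -, rfl⟩; exact x.2))
    rw [← hT', Subtype.val_injective.encard_image]
    refine (indepLe_induce _ k).1 hB.2 _ ?_ fun x hx y hy hxy => ?_
    · intro x hx
      obtain ⟨y, hy, e⟩ := hT hx
      rwa [← Subtype.ext e]
    · exact hind hx hy fun e => hxy (Subtype.ext e)

/-! ### Minimal obstructions -/

lemma isCographMinimalObstruction_iff_delete {k : ℕ∞} :
    IsCographMinimalObstruction G ⊤ k ↔
      IsCograph G ∧ ¬ IsPolar G ⊤ k ∧ ∀ x : V, IsPolar (G.induce {x}ᶜ) ⊤ k := by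
  refine and_congr_right fun _ => and_congr_right fun _ => ⟨fun h x => h _ ?_, fun h X hX => ?_⟩
  · intro e
    have : x ∈ ({x}ᶜ : Set V) := e ▸ trivial
    exact this rfl
  · obtain ⟨x, hx⟩ := (Set.ne_univ_iff_exists_notMem X).1 hX
    refine (h x).of_embedding (induceHomOfLE G ?_)
    intro y hy e
    exact hx (e ▸ hy)

lemma IsCographMinimalObstruction.of_iso {k : ℕ∞} (e : G ≃g H)
    (h : IsCographMinimalObstruction H ⊤ k) : IsCographMinimalObstruction G ⊤ k := by
  refine ⟨fun ⟨f⟩ => h.1 ⟨e.toEmbedding.comp f⟩, fun hp => h.2.1 (hp.of_embedding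
    e.symm.toEmbedding), fun X hX => ?_⟩
  refine (h.2.2 (e '' X) ?_).of_embedding
    ⟨⟨fun x => ⟨e x, x, x.2, rfl⟩, fun x y hxy =>
      Subtype.ext (e.injective (congrArg Subtype.val hxy))⟩, e.map_adj_iff⟩
  intro he
  exact hX (Set.eq_univ_of_forall fun x => by
    have : e x ∈ e '' X := he ▸ trivial
    obtain ⟨y, hy, hyx⟩ := this
    rwa [← e.injective hyx])

/-- A non-polar graph embedded in a minimal obstruction is isomorphic to it. -/
lemma IsCographMinimalObstruction.nonempty_iso_of_embedding {k : ℕ∞}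
    (h : IsCographMinimalObstruction G ⊤ k) (f : H ↪g G) (hH : ¬ IsPolar H ⊤ k) :
    Nonempty (G ≃g H) := by
  have hr : Set.range f = Set.univ := by
    by_contra hne
    refine hH ((h.2.2 _ hne).of_embedding (G := H) ⟨⟨fun x => ⟨f x, x, rfl⟩, ?_⟩, ?_⟩)
    · intro x y hxy
      exact f.injective (congrArg Subtype.val hxy)
    · intro x y
      exact f.map_adj_iff
  exact ⟨(RelIso.ofSurjective f (Set.range_eq_univ.1 hr)).symm⟩

end Sets

/-! ### Isolated vertices and the graphs `n K₁ + H` -/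

section Sums

variable {V : Type u} {W : Type v} {G : SimpleGraph V} {H : SimpleGraph W}

lemma supp_connectedComponentMk_eq_singleton_iff {x : V} :
    (G.connectedComponentMk x).supp = {x} ↔ ∀ y, ¬ G.Adj x y := by
  constructor
  · intro h y hxy
    have hy : y ∈ (G.connectedComponentMk x).supp :=
      ConnectedComponent.sound hxy.symm.reachable
    rw [h] at hy
    exact hxy.ne (Set.mem_singleton_iff.1 hy).symm
  · intro h
    refine Set.eq_singleton_iff_unique_mem.2 ⟨rfl, fun y hy => ?_⟩
    obtain ⟨p⟩ := (ConnectedComponent.exact hy).symm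
    cases p with
    | nil => rfl
    | cons hxz _ => exact absurd hxz (h _)

lemma encard_trivial_components :
    {C : G.ConnectedComponent | ∃ x : V, C.supp = {x}}.encard =
      {x : V | ∀ y, ¬ G.Adj x y}.encard := by
  have himg : {C : G.ConnectedComponent | ∃ x : V, C.supp = {x}} =
      G.connectedComponentMk '' {x : V | ∀ y, ¬ G.Adj x y} := by
    ext C
    constructor
    · rintro ⟨x, hx⟩
      have hxC : G.connectedComponentMk x = C := by
        rw [← ConnectedComponent.mem_supp_iff, hx]; rfl
      refine ⟨x, ?_, hxC⟩
      rw [← hxC] at hx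
      exact supp_connectedComponentMk_eq_singleton_iff.1 hx
    · rintro ⟨x, hx, rfl⟩
      exact ⟨x, supp_connectedComponentMk_eq_singleton_iff.2 hx⟩
  rw [himg]
  refine Set.InjOn.encard_image fun x hx y hy hxy => ?_
  have : x ∈ (G.connectedComponentMk y).supp := hxy
  rw [supp_connectedComponentMk_eq_singleton_iff.2 hy] at this
  exact this

lemma HasType.of_iso {c i : ℕ} (e : G ≃g H) (h : HasType H c i) : HasType G c i := by
  refine ⟨(ENat.card_congr e.connectedComponentEquiv).trans h.1, ?_⟩
  rw [encard_trivial_components, ← h.2, encard_trivial_components, ← e.injective.encard_image]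
  congr 1
  ext y
  constructor
  · rintro ⟨x, hx, rfl⟩ z hz
    exact hx (e.symm z) (by rw [← e.map_adj_iff, e.apply_symm_apply]; exact hz)
  · intro hy
    refine ⟨e.symm y, fun z hz => hy (e z) ?_, e.apply_symm_apply y⟩
    rwa [← e.map_adj_iff, e.apply_symm_apply] at hz

lemma exists_adj_of_isCompleteMultipartite (hH : H.IsCompleteMultipartite) {a b : W}
    (hab : H.Adj a b) (x : W) : ∃ y, H.Adj x y := by
  by_contra! h
  exact hH.trans a x b (fun e => h a e.symm) (h b) hab

lemma reachable_of_isCompleteMultipartite (hH : H.IsCompleteMultipartite) {a b : W}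
    (hab : H.Adj a b) (x y : W) : H.Reachable x y := by
  by_cases hxy : H.Adj x y
  · exact hxy.reachable
  obtain ⟨z, hxz⟩ := exists_adj_of_isCompleteMultipartite hH hab x
  have hyz : H.Adj y z := by
    by_contra hyz
    exact hH.trans x y z hxy hyz hxz
  exact hxz.reachable.trans hyz.symm.reachable

lemma hasType_isolated_sum (n : ℕ) (hH : H.IsCompleteMultipartite) {a b : W}
    (hab : H.Adj a b) : HasType (SimpleGraph.sum (isolated n) H) (n + 1) n := by
  set S := SimpleGraph.sum (isolated n) H with hS
  have hiso : {x | ∀ y, ¬ S.Adj x y} = Sum.inl '' Set.univ := by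
    ext x
    rcases x with i | w
    · simp only [Set.mem_ofPred_eq, Set.image_univ, Set.mem_range, Sum.inl.injEq, exists_eq,
        iff_true]
      rintro (j | w) <;> simp [hS, isolated]
    · simp only [Set.mem_ofPred_eq, Set.image_univ, Set.mem_range, reduceCtorEq, exists_false,
        iff_false, not_forall, not_not]
      obtain ⟨y, hy⟩ := exists_adj_of_isCompleteMultipartite hH hab w
      exact ⟨Sum.inr y, by simpa [hS] using hy⟩
  constructor
  · let f : Option (Fin n) → S.ConnectedComponent := fun o =>
      o.elim (S.connectedComponentMk (Sum.inr a)) fun i => S.connectedComponentMk (Sum.inl i)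
    have hl : ∀ i : Fin n, (S.connectedComponentMk (Sum.inl i)).supp = {Sum.inl i} := by
      intro i
      rw [supp_connectedComponentMk_eq_singleton_iff]
      have : Sum.inl i ∈ {x | ∀ y, ¬ S.Adj x y} := by rw [hiso]; exact ⟨i, trivial, rfl⟩
      exact this
    have hne : ∀ (i : Fin n) (x : Fin n ⊕ W),
        S.connectedComponentMk x = S.connectedComponentMk (Sum.inl i) → x = Sum.inl i := by
      intro i x hx
      have : x ∈ (S.connectedComponentMk (Sum.inl i)).supp := hx
      rwa [hl i] at this
    have hf : Function.Bijective f := by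
      constructor
      · rintro (_ | i) (_ | j) hij
        · rfl
        · exact absurd (hne j _ hij) (by simp)
        · exact absurd (hne i _ hij.symm) (by simp)
        · exact congrArg some (Sum.inl.inj (hne j _ hij))
      · intro C
        induction C using ConnectedComponent.ind with
        | _ x =>
          rcases x with i | w
          · exact ⟨some i, rfl⟩
          · exact ⟨none, ConnectedComponent.sound
              ((reachable_of_isCompleteMultipartite hH hab a w).map
                (Embedding.sumInr : H ↪g S).toHom)⟩
    rw [← ENat.card_congr (Equiv.ofBijective f hf)]
    simp
  · rw [encard_trivial_components, hiso, Sum.inl_injective.encard_image, Set.encard_univ]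
    simp

/-- Every vertex of a path has a neighbour, so an induced path lies in `H`. There an end of the path
is non-adjacent to both ends of the opposite edge, which complete multipartiteness forbids. -/
lemma isCograph_isolated_sum (n : ℕ) (hH : H.IsCompleteMultipartite) :
    IsCograph (SimpleGraph.sum (isolated n) H) := by
  rintro ⟨f⟩
  have hr : ∀ i j : Fin 4, (pathGraph 4).Adj i j → ∃ w, f i = Sum.inr w := by
    intro i j hij
    have hij' := f.map_adj_iff.2 hij
    rcases hi : f i with l | w
    · rcases hj : f j with l' | w' <;> rw [hi, hj] at hij' <;> simp [isolated] at hij'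
    · exact ⟨w, rfl⟩
  have hP : ∀ i j : Fin 4, (pathGraph 4).Adj i j ↔ (i : ℕ) + 1 = j ∨ (j : ℕ) + 1 = i :=
    fun i j => pathGraph_adj
  obtain ⟨a, ha⟩ := hr 0 1 (by simp [hP])
  obtain ⟨b, hb⟩ := hr 1 2 (by simp [hP])
  obtain ⟨d, hd⟩ := hr 3 2 (by simp [hP])
  have hab : H.Adj a b := by
    have : (SimpleGraph.sum (isolated n) H).Adj (f 0) (f 1) := f.map_adj_iff.2 (by simp [hP])
    simpa [ha, hb] using this
  have had : ¬ H.Adj a d := by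
    have : ¬ (SimpleGraph.sum (isolated n) H).Adj (f 0) (f 3) :=
      fun h => by simpa [hP] using f.map_adj_iff.1 h
    simpa [ha, hd] using this
  have hdb : ¬ H.Adj d b := by
    have : ¬ (SimpleGraph.sum (isolated n) H).Adj (f 3) (f 1) :=
      fun h => by simpa [hP] using f.map_adj_iff.1 h
    simpa [hb, hd] using this
  exact hH.trans a d b had hdb hab

/-- If `(k + 1) K₁ + H` is polar then `H` splits into an independent set and a `k`-cluster. -/
lemma exists_indep_cover_of_isPolar_isolated_sum {k : ℕ}
    (h : IsPolar (SimpleGraph.sum (isolated (k + 1)) H) ⊤ k) :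
    ∃ A B : Set W, (∀ x, x ∈ A ∨ x ∈ B) ∧ H.IsIndepSet A ∧ ClusterOn H B ∧ IndepLe H B k := by
  obtain ⟨A, B, hAB, hA, hB, hk⟩ := (isPolar_iff _).1 h
  have hex : ∃ i : Fin (k + 1), Sum.inl i ∈ A := by
    by_contra! hn
    have hcard := hk (Sum.inl '' Set.univ)
      (by rintro _ ⟨i, -, rfl⟩; exact (hAB _).resolve_left (hn i))
      (by rintro _ ⟨i, -, rfl⟩ _ ⟨j, -, rfl⟩ _; simp [isolated])
    rw [Sum.inl_injective.encard_image, Set.encard_univ] at hcard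
    simp only [ENat.card_eq_coe_fintype_card, Fintype.card_fin] at hcard
    have := ENat.natCast_le_natCast.1 hcard
    omega
  obtain ⟨i, hi⟩ := hex
  refine ⟨Sum.inr ⁻¹' A, Sum.inr ⁻¹' B, fun x => hAB _, ?_,
    hB.preimage Embedding.sumInr, hk.preimage Embedding.sumInr⟩
  -- All of `A` is non-adjacent to the isolated vertex in it, hence lies in a single part.
  intro x hx y hy _ hxy
  exact hA hx hi hy (by simp) (by simp) (by simpa using hxy)

/-- After deleting an isolated vertex, `H` is the multipartite side and the other `k` isolated
vertices are the cluster. After deleting a vertex of `H`, all isolated vertices join the independent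
set. -/
lemma isCographMinimalObstruction_isolated_sum {k : ℕ} (hH : H.IsCompleteMultipartite)
    (hnot : ¬ IsPolar (SimpleGraph.sum (isolated (k + 1)) H) ⊤ k)
    (hdel : ∀ w : W, ∃ A B : Set W, {w}ᶜ ⊆ A ∪ B ∧ H.IsIndepSet A ∧ ClusterOn H B ∧
      IndepLe H B k) :
    IsCographMinimalObstruction (SimpleGraph.sum (isolated (k + 1)) H) ⊤ k := by
  refine isCographMinimalObstruction_iff_delete.2 ⟨isCograph_isolated_sum _ hH, hnot, ?_⟩
  rintro (i | w)
  · refine isPolar_induce_of_cover (A := Sum.inr '' Set.univ) (B := Sum.inl '' {i}ᶜ) ?_ ?_ ?_ ?_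
    · rintro (j | w) hj
      · exact Or.inr ⟨j, fun e => hj (congrArg _ e), rfl⟩
      · exact Or.inl ⟨w, trivial, rfl⟩
    · rintro _ ⟨x, -, rfl⟩ _ ⟨y, -, rfl⟩ _ ⟨z, -, rfl⟩
      simpa using hH.trans x y z
    · apply ClusterOn.of_isIndepSet
      rintro _ ⟨x, -, rfl⟩ _ ⟨y, -, rfl⟩ _
      simp [isolated]
    · apply IndepLe.of_encard_le
      rw [Sum.inl_injective.encard_image, Set.encard_eq_coe_toFinset_card]
      simp [Finset.card_compl, Set.toFinset_compl]
  · obtain ⟨A, B, hAB, hA, hB, hk⟩ := hdel w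
    refine isPolar_induce_of_cover (A := Set.range Sum.inl ∪ Sum.inr '' A)
      (B := Sum.inr '' B) ?_ ?_ ?_ ?_
    · rintro (j | x) hx
      · exact Or.inl (Or.inl ⟨j, rfl⟩)
      · rcases hAB (fun e => hx (congrArg _ e) : x ∈ ({w}ᶜ : Set W)) with h | h
        · exact Or.inl (Or.inr ⟨x, h, rfl⟩)
        · exact Or.inr ⟨x, h, rfl⟩
    · apply MultipartiteOn.of_isIndepSet
      rintro _ (⟨x, rfl⟩ | ⟨x, hx, rfl⟩) _ (⟨y, rfl⟩ | ⟨y, hy, rfl⟩) hxy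
      · simp [isolated]
      · simp
      · simp
      · simpa using hA hx hy fun e => hxy (congrArg _ e)
    · rintro _ ⟨x, hx, rfl⟩ _ ⟨y, hy, rfl⟩ _ ⟨z, hz, rfl⟩ hxy hyz hxz
      simpa using hB hx hy hz (by simpa using hxy) (by simpa using hyz)
        fun e => hxz (congrArg _ e)
    · intro T hT hind
      have hT' : Sum.inr '' (Sum.inr ⁻¹' T : Set W) = T :=
        Set.image_preimage_eq_of_subset (hT.trans (Set.image_subset_range _ _))
      rw [← hT', Sum.inr_injective.encard_image]
      refine hk _ (fun x hx => ?_) fun x hx y hy hxy => ?_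
      · obtain ⟨y, hy, e⟩ := hT hx
        rwa [← Sum.inr_injective e]
      · simpa using hind hx hy (Sum.inr_injective.ne hxy)

end Sums

/-! ### The two obstructions -/

section Obstructions

lemma isCompleteMultipartite_completeBipartiteGraph (V : Type u) (W : Type v) :
    (completeBipartiteGraph V W).IsCompleteMultipartite := by
  refine ⟨?_⟩
  rintro (x | x) (y | y) (z | z) <;> simp

lemma isIndepSet_range_inl (V : Type u) (W : Type v) :
    (completeBipartiteGraph V W).IsIndepSet (Set.range Sum.inl) := by
  rintro _ ⟨x, rfl⟩ _ ⟨y, rfl⟩ _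
  simp

lemma isIndepSet_range_inr (V : Type u) (W : Type v) :
    (completeBipartiteGraph V W).IsIndepSet (Set.range Sum.inr) := by
  rintro _ ⟨x, rfl⟩ _ ⟨y, rfl⟩ _
  simp

/-- An independent set misses one side entirely, leaving `k + 1` independent vertices to the
cluster. -/
lemma not_isPolar_isolated_sum_completeBipartiteGraph (k : ℕ) :
    ¬ IsPolar (SimpleGraph.sum (isolated (k + 1))
      (completeBipartiteGraph (Fin (k + 1)) (Fin (k + 1)))) ⊤ k := by
  intro h
  obtain ⟨A, B, hAB, hA, hB, hI⟩ := exists_indep_cover_of_isPolar_isolated_sum h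
  have hcard : ¬ ((k + 1 : ℕ) : ℕ∞) ≤ k := by
    rw [ENat.natCast_le_natCast]; omega
  by_cases hl : ∃ i, Sum.inl i ∈ A
  · obtain ⟨i, hi⟩ := hl
    have hr : ∀ j, Sum.inr j ∈ B := fun j =>
      (hAB _).resolve_left fun hj => hA hi hj (by simp) (by simp)
    refine hcard ?_
    have := hI (Set.range Sum.inr) (by rintro _ ⟨j, rfl⟩; exact hr j) (isIndepSet_range_inr _ _)
    rw [← Set.image_univ, Sum.inr_injective.encard_image, Set.encard_univ] at this
    simpa using this
  · push Not at hl
    have hl' : ∀ i, Sum.inl i ∈ B := fun i => (hAB _).resolve_left (hl i)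
    refine hcard ?_
    have := hI (Set.range Sum.inl) (by rintro _ ⟨j, rfl⟩; exact hl' j) (isIndepSet_range_inl _ _)
    rw [← Set.image_univ, Sum.inl_injective.encard_image, Set.encard_univ] at this
    simpa using this

lemma isCographMinimalObstruction_completeBipartiteGraph (k : ℕ) :
    IsCographMinimalObstruction (SimpleGraph.sum (isolated (k + 1))
      (completeBipartiteGraph (Fin (k + 1)) (Fin (k + 1)))) ⊤ k := by
  refine isCographMinimalObstruction_isolated_sum
    (isCompleteMultipartite_completeBipartiteGraph _ _)
    (not_isPolar_isolated_sum_completeBipartiteGraph k) ?_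
  have hcard : ∀ i : Fin (k + 1), ({i}ᶜ : Set (Fin (k + 1))).encard ≤ k := by
    intro i
    rw [Set.encard_eq_coe_toFinset_card]
    simp [Finset.card_compl, Set.toFinset_compl]
  rintro (i | i)
  · have hsub : Sum.inl '' {i}ᶜ ⊆ Set.range (Sum.inl : _ → Fin (k + 1) ⊕ Fin (k + 1)) :=
      Set.image_subset_range _ _
    refine ⟨Set.range Sum.inr, Sum.inl '' {i}ᶜ, ?_, isIndepSet_range_inr _ _,
      ClusterOn.of_isIndepSet ((isIndepSet_range_inl _ _).mono hsub),
      IndepLe.of_encard_le ((Sum.inl_injective.encard_image _).trans_le (hcard i))⟩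
    rintro (j | j) hj
    · exact Or.inr ⟨j, fun e => hj (congrArg _ e), rfl⟩
    · exact Or.inl ⟨j, rfl⟩
  · have hsub : Sum.inr '' {i}ᶜ ⊆ Set.range (Sum.inr : _ → Fin (k + 1) ⊕ Fin (k + 1)) :=
      Set.image_subset_range _ _
    refine ⟨Set.range Sum.inl, Sum.inr '' {i}ᶜ, ?_, isIndepSet_range_inl _ _,
      ClusterOn.of_isIndepSet ((isIndepSet_range_inr _ _).mono hsub),
      IndepLe.of_encard_le ((Sum.inr_injective.encard_image _).trans_le (hcard i))⟩
    rintro (j | j) hj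
    · exact Or.inl ⟨j, rfl⟩
    · exact Or.inr ⟨j, fun e => hj (congrArg _ e), rfl⟩

/-- The wheel `K₁ ⊕ C₄`. -/
abbrev wheelFour : SimpleGraph (Fin 1 ⊕ Fin 4) :=
  join (completeGraph (Fin 1)) (cycleGraph 4)

@[simp] lemma wheelFour_adj_inl_inl (i j : Fin 1) :
    ¬ wheelFour.Adj (Sum.inl i) (Sum.inl j) := fun h => h (Subsingleton.elim i j)

@[simp] lemma wheelFour_adj_inl_inr (i : Fin 1) (j : Fin 4) :
    wheelFour.Adj (Sum.inl i) (Sum.inr j) := trivial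

@[simp] lemma wheelFour_adj_inr_inl (i : Fin 1) (j : Fin 4) :
    wheelFour.Adj (Sum.inr j) (Sum.inl i) := trivial

lemma cycleGraph_four_adj (i j : Fin 4) :
    (cycleGraph 4).Adj i j ↔ (i : ℕ) % 2 ≠ (j : ℕ) % 2 := by
  rw [cycleGraph_adj]
  revert i j
  decide

@[simp] lemma wheelFour_adj_inr_inr (i j : Fin 4) :
    wheelFour.Adj (Sum.inr i) (Sum.inr j) ↔ (i : ℕ) % 2 ≠ (j : ℕ) % 2 :=
  cycleGraph_four_adj i j

lemma isCompleteMultipartite_wheelFour : wheelFour.IsCompleteMultipartite := by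
  refine ⟨?_⟩
  rintro (x | x) (y | y) (z | z) <;> simp
  exact fun h h' => h.trans h'

lemma not_isPolar_isolated_sum_wheelFour (k : ℕ) :
    ¬ IsPolar (SimpleGraph.sum (isolated (k + 1)) wheelFour) ⊤ k := by
  intro h
  obtain ⟨A, B, hAB, hA, hB, -⟩ := exists_indep_cover_of_isPolar_isolated_sum h
  have hadj : ∀ {x y}, x ∈ A → wheelFour.Adj x y → y ∈ B := fun {x y} hx hxy =>
    (hAB y).resolve_left fun hy => hA hx hy hxy.ne hxy
  -- With the hub in `A`, the whole rim is in `B`, but `C₄` is not a cluster. With the hub in `B`,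
  -- opposite rim vertices cannot both be in `B` (`key`) and adjacent ones cannot both avoid it
  -- (`hopp`).
  by_cases hc : Sum.inl 0 ∈ A
  · have hr : ∀ i, Sum.inr i ∈ B := fun i => hadj hc (by simp)
    have := hB (hr 0) (hr 1) (hr 2) (by simp) (by simp) (by simp)
    simp at this
  · have hc' := (hAB _).resolve_left hc
    have key : ∀ i j : Fin 4, i ≠ j → (i : ℕ) % 2 = (j : ℕ) % 2 → Sum.inr i ∈ B →
        Sum.inr j ∉ B := by
      intro i j hij hmod hi hj
      have := hB hi hc' hj (by simp) (by simp) (by simpa using hij)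
      simp [hmod] at this
    have hopp : ∀ i j : Fin 4, (i : ℕ) % 2 ≠ (j : ℕ) % 2 → Sum.inr i ∉ B → Sum.inr j ∈ B :=
      fun i j hij hi => hadj ((hAB _).resolve_right hi) (by simpa using hij)
    by_cases h0 : Sum.inr 0 ∈ B
    · have h2 := key 0 2 (by simp) (by simp) h0
      exact key 1 3 (by simp) (by simp) (hopp 2 1 (by simp) h2) (hopp 2 3 (by simp) h2)
    · exact key 1 3 (by simp) (by simp) (hopp 0 1 (by simp) h0) (hopp 0 3 (by simp) h0)

lemma isCographMinimalObstruction_wheelFour {k : ℕ} (hk : 2 ≤ k) :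
    IsCographMinimalObstruction (SimpleGraph.sum (isolated (k + 1)) wheelFour) ⊤ k := by
  refine isCographMinimalObstruction_isolated_sum isCompleteMultipartite_wheelFour
    (not_isPolar_isolated_sum_wheelFour k) ?_
  have hind : ∀ i j : Fin 4, (i : ℕ) % 2 = (j : ℕ) % 2 →
      wheelFour.IsIndepSet {Sum.inr i, Sum.inr j} := by
    rintro i j hij _ (rfl | rfl) _ (rfl | rfl) _ <;> simp [hij]
  rintro (i | i)
  -- Without the hub, each opposite pair is independent; the one used as a cluster has two
  -- components, whence `2 ≤ k`.
  · refine ⟨{Sum.inr 0, Sum.inr 2}, {Sum.inr 1, Sum.inr 3}, ?_, hind _ _ rfl,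
      ClusterOn.of_isIndepSet (hind _ _ rfl), IndepLe.of_encard_le ?_⟩
    · rintro (j | j) hj
      · exact absurd (congrArg Sum.inl (Subsingleton.elim j i)) hj
      · fin_cases j <;> simp
    · refine (Set.encard_insert_le _ _).trans ?_
      rw [Set.encard_singleton]
      exact_mod_cast hk
  -- Without the rim vertex `i`, its two neighbours are independent, and the hub with the vertex
  -- opposite `i` forms an edge.
  · have hclique : wheelFour.IsClique {Sum.inl 0, Sum.inr (i + 2)} := by
      rintro _ (rfl | rfl) _ (rfl | rfl) hne <;> first | exact absurd rfl hne | simp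
    refine ⟨{Sum.inr (i + 1), Sum.inr (i + 3)}, {Sum.inl 0, Sum.inr (i + 2)}, ?_,
      hind _ _ ?_, ClusterOn.of_isClique hclique,
      IndepLe.of_isClique hclique (by exact_mod_cast (by omega : 1 ≤ k))⟩
    · rintro (j | j) hj
      · exact Or.inr (Or.inl (congrArg Sum.inl (Subsingleton.elim j 0)))
      · have hij : j ≠ i := fun e => hj (congrArg _ e)
        have : j = i + 1 ∨ j = i + 3 ∨ j = i + 2 := by
          clear hj hclique; revert i j; decide
        rcases this with e | e | e <;> simp [e]
    · clear hclique; revert i; decide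

end Obstructions

/-! ### Structure of obstructions with `k + 1` isolated vertices -/

section Structure

variable {V : Type u} {W : Type v} {G : SimpleGraph V} {H : SimpleGraph W}

/-- In a minimal obstruction with `k + 1` isolated vertices, the remaining vertices induce a
complete multipartite graph. -/
lemma IsCographMinimalObstruction.multipartiteOn {k : ℕ}
    (h : IsCographMinimalObstruction G ⊤ k) (hI : {x | ∀ y, ¬ G.Adj x y}.encard = (k + 1 : ℕ)) :
    MultipartiteOn G {x | ∃ y, G.Adj x y} := by
  set I : Set V := {x | ∀ y, ¬ G.Adj x y} with hIdef
  obtain ⟨x₀, hx₀⟩ : I.Nonempty := by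
    rw [← Set.encard_ne_zero, hI]
    simp
  have hne : ({x₀}ᶜ : Set V) ≠ Set.univ := fun e => by
    have : x₀ ∈ ({x₀}ᶜ : Set V) := e ▸ trivial
    exact this rfl
  obtain ⟨A, B, hAB, hA, hB, hk⟩ := exists_cover_of_isPolar_induce (h.2.2 _ hne)
  have hdisj : ∀ x ∈ I, x ∉ A := by
    intro x hx hxA
    have hAI : G.IsIndepSet A := fun y hy z hz _ =>
      hA hy hxA hz (fun e => hx y e.symm) (hx z)
    refine h.2.1 ((isPolar_iff _).2 ⟨insert x₀ A, B, fun y => ?_,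
      MultipartiteOn.of_isIndepSet ?_, hB, hk⟩)
    · by_cases hy : y = x₀
      · exact Or.inl (Or.inl hy)
      · have : y ∈ A ∪ B := hAB ▸ hy
        exact this.imp Or.inr id
    · rintro y (rfl | hy) z (rfl | hz) hyz
      · exact hx₀ _
      · exact hx₀ z
      · exact fun e => hx₀ y e.symm
      · exact hAI hy hz hyz
  have hIB : I \ {x₀} ⊆ B := fun x hx => by
    have : x ∈ A ∪ B := hAB ▸ hx.2
    exact this.resolve_left (hdisj x hx.1)
  have hcard : (I \ {x₀}).encard + 1 = (k : ℕ∞) + 1 := by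
    rw [Set.encard_sdiff_singleton_add_one hx₀, hI]
    simp
  have hsub : {x | ∃ y, G.Adj x y} ⊆ A := by
    rintro x ⟨y, hxy⟩
    have hx : x ∈ A ∪ B := by
      rw [← hAB]
      rintro rfl
      exact hx₀ y hxy
    refine hx.resolve_right fun hxB => ?_
    -- A non-isolated `x` in `B` together with the `k` remaining isolated vertices would be `k + 1`
    -- independent vertices of `B`.
    have hle := hk (insert x (I \ {x₀})) (Set.insert_subset hxB hIB) ?_
    · rw [Set.encard_insert_of_notMem fun hxI => hxI.1 y hxy, hcard] at hle
      have : k + 1 ≤ k := by exact_mod_cast hle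
      omega
    · rintro a (rfl | ha) b (rfl | hb) hab
      · exact absurd rfl hab
      · exact fun e => hb.1 _ e.symm
      · exact ha.1 _
      · exact ha.1 _
  exact fun x hx y hy z hz => hA (hsub hx) (hsub hy) (hsub hz)

/-- An embedding into the non-isolated vertices extends by isolated vertices. -/
lemma nonempty_embedding_isolated_sum {n : ℕ} (hI : {x | ∀ y, ¬ G.Adj x y}.encard = n)
    (f : H ↪g G) (hf : ∀ w, ∃ y, G.Adj (f w) y) :
    Nonempty (SimpleGraph.sum (isolated n) H ↪g G) := by
  set I : Set V := {x | ∀ y, ¬ G.Adj x y} with hIdef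
  obtain ⟨g⟩ : Nonempty (Fin n ↪ I) := by
    have hfin : I.Finite := Set.finite_of_encard_eq_coe hI
    have hc : Nat.card I = n := by
      rw [Nat.card_coe_set_eq, Set.ncard, hI]; simp
    have := hfin.to_subtype
    exact ⟨(Finite.equivFinOfCardEq hc).symm.toEmbedding⟩
  have hfI : ∀ w, f w ∉ I := fun w hw => (hf w).elim hw
  refine ⟨⟨⟨Sum.elim (fun i => (g i : V)) f, ?_⟩, ?_⟩⟩
  · refine Function.Injective.sumElim (Subtype.val_injective.comp g.injective) f.injective ?_
    intro i w e
    exact hfI w (e ▸ (g i).2)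
  · rintro (i | w) (j | w')
    · simpa [isolated] using (g i).2 _
    · simpa using (g i).2 _
    · simpa using fun e : G.Adj (f w) (g j) => (g j).2 _ e.symm
    · simp

/-- Inside a complete multipartite graph the `K₁ ⊕ C₄` is detected by an apex and two non-adjacent
pairs. -/
lemma nonempty_wheelFour_embedding {a b c d e : V} (hab : ¬ G.Adj a b) (hcd : ¬ G.Adj c d)
    (hab' : a ≠ b) (hcd' : c ≠ d) (hac : G.Adj a c) (had : G.Adj a d) (hbc : G.Adj b c)
    (hbd : G.Adj b d) (hea : G.Adj e a) (heb : G.Adj e b) (hec : G.Adj e c) (hed : G.Adj e d) :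
    ∃ f : wheelFour ↪g G, ∀ w, ∃ y, G.Adj (f w) y := by
  -- The order `a, c, b, d` places the two non-adjacent pairs opposite each other on the cycle.
  have hadj : ∀ x y, G.Adj (Sum.elim (fun _ : Fin 1 => e) ![a, c, b, d] x)
      (Sum.elim (fun _ : Fin 1 => e) ![a, c, b, d] y) ↔ wheelFour.Adj x y := by
    rintro (i | i) (j | j)
    · simp
    · fin_cases j <;> simp [*]
    · fin_cases i <;> simp [hea.symm, heb.symm, hec.symm, hed.symm]
    · fin_cases i <;> fin_cases j <;>
        simp [*, hac.symm, had.symm, hbc.symm, hbd.symm, G.adj_comm b a, G.adj_comm d c]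
  refine ⟨⟨⟨Sum.elim (fun _ => e) ![a, c, b, d], ?_⟩, hadj _ _⟩, fun w => ?_⟩
  · rintro (i | i) (j | j) hij
    · exact congrArg _ (Subsingleton.elim i j)
    · fin_cases j <;> simp [hea.ne, heb.ne, hec.ne, hed.ne] at hij
    · fin_cases i <;> simp [hea.ne', heb.ne', hec.ne', hed.ne'] at hij
    · fin_cases i <;> fin_cases j <;>
        simp [hac.ne, had.ne, hbc.ne, hbd.ne, hac.ne', had.ne', hbc.ne', hbd.ne', hab', hcd',
          hab'.symm, hcd'.symm] at hij ⊢
  · obtain ⟨z, hz⟩ := exists_adj_of_isCompleteMultipartite isCompleteMultipartite_wheelFour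
      (wheelFour_adj_inl_inr 0 0) w
    exact ⟨_, (hadj _ _).2 hz⟩

lemma nonempty_completeBipartiteGraph_embedding {n : ℕ} (hn : 0 < n) {P Q : Set V}
    (hP : (n : ℕ∞) ≤ P.encard) (hQ : (n : ℕ∞) ≤ Q.encard) (hPi : G.IsIndepSet P)
    (hQi : G.IsIndepSet Q) (hPQ : ∀ x ∈ P, ∀ y ∈ Q, G.Adj x y) :
    ∃ f : completeBipartiteGraph (Fin n) (Fin n) ↪g G, ∀ w, ∃ y, G.Adj (f w) y := by
  have hemb : ∀ S : Set V, (n : ℕ∞) ≤ S.encard → ∃ g : Fin n → V,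
      Function.Injective g ∧ ∀ i, g i ∈ S := by
    intro S hS
    obtain ⟨T, hTS, hT⟩ := Set.exists_subset_encard_eq hS
    have hfin : T.Finite := Set.finite_of_encard_eq_coe hT
    have hc : Nat.card T = n := by
      rw [Nat.card_coe_set_eq, Set.ncard, hT]; simp
    have := hfin.to_subtype
    let g := (Finite.equivFinOfCardEq hc).symm
    exact ⟨fun i => g i, Subtype.val_injective.comp g.injective, fun i => hTS (g i).2⟩
  obtain ⟨p, hp, hpP⟩ := hemb P hP
  obtain ⟨q, hq, hqQ⟩ := hemb Q hQ
  have hpq : ∀ i j, G.Adj (p i) (q j) := fun i j => hPQ _ (hpP i) _ (hqQ j)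
  have hpp : ∀ i j, ¬ G.Adj (p i) (p j) := fun i j h => hPi (hpP i) (hpP j) h.ne h
  have hqq : ∀ i j, ¬ G.Adj (q i) (q j) := fun i j h => hQi (hqQ i) (hqQ j) h.ne h
  refine ⟨⟨⟨Sum.elim p q, hp.sumElim hq fun i j => (hpq i j).ne⟩, ?_⟩, ?_⟩
  · rintro (i | i) (j | j)
    · simpa using hpp i j
    · simpa using hpq i j
    · simpa using (hpq j i).symm
    · simpa using hqq i j
  · rintro (i | i)
    · exact ⟨_, hpq i ⟨0, hn⟩⟩
    · exact ⟨_, (hpq ⟨0, hn⟩ i).symm⟩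

/-- A non-polar graph whose non-isolated vertices induce a complete multipartite graph contains
`K_{k+1,k+1}` or `K₁ ⊕ C₄`. -/
lemma exists_embedding_of_not_isPolar {k : ℕ} (hk : 1 ≤ k) (hG : ¬ IsPolar G ⊤ k)
    (hM : MultipartiteOn G {x | ∃ y, G.Adj x y}) :
    (∃ f : completeBipartiteGraph (Fin (k + 1)) (Fin (k + 1)) ↪g G, ∀ w, ∃ y, G.Adj (f w) y) ∨
      ∃ f : wheelFour ↪g G, ∀ w, ∃ y, G.Adj (f w) y := by
  have hk' : (1 : ℕ∞) ≤ k := by exact_mod_cast hk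
  have hT : ∀ {x y z : V}, (∃ w, G.Adj x w) → (∃ w, G.Adj y w) → (∃ w, G.Adj z w) →
      ¬ G.Adj x y → ¬ G.Adj y z → ¬ G.Adj x z := fun hx hy hz => hM hx hy hz
  -- Otherwise the non-isolated vertices form one clique, and the isolated ones an independent set.
  obtain ⟨a, b, hab', ⟨a', ha⟩, ⟨b', hb⟩, hab⟩ : ∃ a b : V, a ≠ b ∧ (∃ y, G.Adj a y) ∧
      (∃ y, G.Adj b y) ∧ ¬ G.Adj a b := by
    by_contra! hc
    have hclique : G.IsClique {x | ∃ y, G.Adj x y} := fun x hx y hy hxy => hc x y hxy hx hy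
    refine hG ((isPolar_iff _).2 ⟨{x | ∀ y, ¬ G.Adj x y}, {x | ∃ y, G.Adj x y}, fun x => ?_,
      MultipartiteOn.of_isIndepSet fun x hx y _ _ => hx y, ClusterOn.of_isClique hclique,
      IndepLe.of_isClique hclique hk'⟩)
    by_cases h : ∃ y, G.Adj x y
    · exact Or.inr h
    · exact Or.inl (not_exists.1 h)
  -- The non-neighbours of a non-isolated `v` are its part and the isolated vertices. So its
  -- neighbourhood cannot be a `k`-cluster (`hcover`).
  have hnon : ∀ {v v' : V}, G.Adj v v' → G.IsIndepSet {x | ¬ G.Adj v x} := by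
    intro v v' hv x hx y hy _ hxy
    exact hT ⟨y, hxy⟩ ⟨v', hv⟩ ⟨x, hxy.symm⟩ (fun e => hx e.symm) hy hxy
  have hcover : ∀ {v v' : V}, G.Adj v v' → ClusterOn G {x | G.Adj v x} →
      ¬ IndepLe G {x | G.Adj v x} k := by
    intro v v' hv hcl hind
    exact hG ((isPolar_iff _).2 ⟨{x | ¬ G.Adj v x}, {x | G.Adj v x}, fun x => (em _).symm,
      MultipartiteOn.of_isIndepSet (hnon hv), hcl, hind⟩)
  obtain ⟨c, d, hac, had, hcd', hcd⟩ : ∃ c d, G.Adj a c ∧ G.Adj a d ∧ c ≠ d ∧ ¬ G.Adj c d := by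
    by_contra! hc
    have hclique : G.IsClique {x | G.Adj a x} := fun x hx y hy hxy => hc x y hx hy hxy
    exact hcover ha (ClusterOn.of_isClique hclique) (IndepLe.of_isClique hclique hk')
  -- A common neighbour of `a` and `c` lies in a third part and serves as hub. If there is none,
  -- only two parts exist, namely the neighbourhoods of `a` and `c`.
  by_cases he : ∃ e, G.Adj a e ∧ G.Adj c e
  · right
    obtain ⟨e, hae, hce⟩ := he
    have hside : ∀ {x y z : V}, ¬ G.Adj x y → (∃ w, G.Adj y w) → G.Adj x z → G.Adj y z := by
      intro x y z hxy hy hxz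
      by_contra hyz
      exact hT ⟨z, hxz⟩ hy ⟨x, hxz.symm⟩ hxy hyz hxz
    exact nonempty_wheelFour_embedding hab hcd hab' hcd' hac had (hside hab ⟨b', hb⟩ hac)
      (hside hab ⟨b', hb⟩ had) hae.symm (hside hab ⟨b', hb⟩ hae).symm hce.symm
      (hside hcd ⟨a, had.symm⟩ hce).symm
  · left
    have hPi : G.IsIndepSet {x | G.Adj a x} :=
      (hnon hac.symm).mono fun x hx hcx => he ⟨x, hx, hcx⟩
    have hQi : G.IsIndepSet {x | G.Adj c x} :=
      (hnon hac).mono fun x hx hax => he ⟨x, hax, hx⟩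
    have hlarge : ∀ {v v' : V}, G.Adj v v' → G.IsIndepSet {x | G.Adj v x} →
        ((k + 1 : ℕ) : ℕ∞) ≤ {x | G.Adj v x}.encard := by
      intro v v' hv hi
      by_contra hlt
      refine hcover hv (ClusterOn.of_isIndepSet hi) (IndepLe.of_encard_le ?_)
      rw [not_le] at hlt
      push_cast at hlt
      exact Order.le_of_lt_add_one hlt
    refine nonempty_completeBipartiteGraph_embedding (by omega) (hlarge hac hPi)
      (hlarge hac.symm hQi) hPi hQi fun x hx y hy => ?_
    by_contra hxy
    have hyc : ¬ G.Adj x c := fun e => he ⟨x, hx, e.symm⟩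
    exact hT ⟨c, hy.symm⟩ ⟨a, hx.symm⟩ ⟨y, hy⟩ (fun e => hxy e.symm) hyc hy.symm

end Structure

end CographPolar

theorem mainTheorem8 {V : Type*} [Finite V] (G : SimpleGraph V) (k : ℕ) (hk : 2 ≤ k) :
    (CographPolar.IsCographMinimalObstruction G ⊤ (k : ℕ∞) ∧
        CographPolar.HasType G (k + 2) (k + 1)) ↔
      (Nonempty (G ≃g
          SimpleGraph.sum (CographPolar.isolated (k + 1))
            (completeBipartiteGraph (Fin (k + 1)) (Fin (k + 1)))) ∨
        Nonempty (G ≃g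
          SimpleGraph.sum (CographPolar.isolated (k + 1))
            (CographPolar.join (SimpleGraph.completeGraph (Fin 1)) (SimpleGraph.cycleGraph 4)))) := by
  open CographPolar in
  constructor
  · rintro ⟨h, -, hI⟩
    rw [encard_trivial_components] at hI
    rcases exists_embedding_of_not_isPolar (by omega) h.2.1 (h.multipartiteOn hI) with
      ⟨f, hf⟩ | ⟨f, hf⟩
    · obtain ⟨g⟩ := nonempty_embedding_isolated_sum hI f hf
      exact Or.inl (h.nonempty_iso_of_embedding g
        (not_isPolar_isolated_sum_completeBipartiteGraph k))
    · obtain ⟨g⟩ := nonempty_embedding_isolated_sum hI f hf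
      exact Or.inr (h.nonempty_iso_of_embedding g (not_isPolar_isolated_sum_wheelFour k))
  · rintro (⟨⟨e⟩⟩ | ⟨⟨e⟩⟩)
    · exact ⟨(isCographMinimalObstruction_completeBipartiteGraph k).of_iso e,
        (hasType_isolated_sum (k + 1) (isCompleteMultipartite_completeBipartiteGraph _ _)
          (a := Sum.inl 0) (b := Sum.inr 0) (by simp)).of_iso e⟩
    · exact ⟨(isCographMinimalObstruction_wheelFour hk).of_iso e,
        (hasType_isolated_sum (k + 1) isCompleteMultipartite_wheelFour
          (wheelFour_adj_inl_inr 0 0)).of_iso e⟩
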